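/- Let $g\ge 0$ and $k\ge 1$ be integers. Let $\mathbb R\langle x\rangle$ be the free algebra in $x=(x_1,\dots,x_g)$ with the involution $*$ that reverses words and satisfies $x_j^*=x_j$, and let $\mathbb R\langle x,x^*\rangle$ be the free algebra in the $2g$ variables $x_1,\dots,x_g,x_1^*,\dots,x_g^*$ with the involution that reverses words and exchanges $x_j$ and $x_j^*$. A polynomial $p$ is symmetric if $p^*=p$, and $\deg p$ is the largest length of a word occurring in $p$ with nonzero coefficient (with $\deg 0:=0$). For $p\in\mathbb R\langle x\rangle$ the $k$-th directional derivative is $$p^{(k)}(x)[h]=\frac{d^k}{dt^k}\,p(x+th)\Big|_{t=0}\in\mathbb R\langle x,h\rangle ,$$ a noncommutative polynomial in the $2g$ variables $(x,h)$, where $h=(h_1,\dots,h_g)$ and $t$ is a scalar variable; for $p\in\mathbb R\langle x,x^*\rangle$ it is defined in the same way, replacing $x_j$ by $x_j+th_j$ and $x_j^*$ by $x_j^*+th_j^*$. 1. Let $p\in\mathbb R\langle x\rangle$ be symmetric. If $p^{(k)}$ is matrix positive, that is, if the matrix $p^{(k)}(X)[H]$ is positive semidefinite for every $n$ and all $g$-tuples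 $X,H$ of symmetric real $n\times n$ matrices, then $\deg p\le k$. 2. Let $p\in\mathbb R\langle x,x^*\rangle$ be symmetric. If $p^{(k)}$ is matrix positive, that is, if for every $n$ and all $g$-tuples $X,H$ of real $n\times n$ matrices the matrix obtained from $p^{(k)}$ by substituting $X_j,\ X_j^{T},\ H_j,\ H_j^{T}$ for $x_j,\ x_j^*,\ h_j,\ h_j^*$ is positive semidefinite, then $\deg p\le k$. -/

import Mathlib

/-!
`FreeAlgebra ℝ V` is the algebra of noncommutative real polynomials in the variables `V`.

* `ℝ⟨x⟩` with symmetric variables `x₁, …, x_g` is `FreeAlgebra ℝ (Fin g)`; Mathlib's `star` on it is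
  the involution which reverses words and fixes every variable.
* `ℝ⟨x, x*⟩` is `FreeAlgebra ℝ (Fin g ⊕ Fin g)`, where `Sum.inl j` is `x_j` and `Sum.inr j` is `x_j*`.
  Its involution is `NCPoly.adjoint` below (Mathlib's `star` fixes all variables, so it is not
  the right one here).
-/

namespace NCPoly

/-- The degree of a noncommutative polynomial: the largest length of a word that occurs in it with
nonzero coefficient (and `0` for the zero polynomial). -/
noncomputable def degree {V : Type} (p : FreeAlgebra ℝ V) : ℕ :=
  (FreeAlgebra.equivMonoidAlgebraFreeMonoid (R := ℝ) (X := V) p).coeff.support.sup FreeMonoid.length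

/-- The involution of `ℝ⟨x, x*⟩`: it reverses words and exchanges `x_j` and `x_j*`. -/
noncomputable def adjoint {g : ℕ} (p : FreeAlgebra ℝ (Fin g ⊕ Fin g)) :
    FreeAlgebra ℝ (Fin g ⊕ Fin g) :=
  star (FreeAlgebra.lift ℝ (fun v => FreeAlgebra.ι ℝ (Sum.swap v)) p)

/-- The polynomial `p(x + t h)` in a central variable `t`, with coefficients noncommutative
polynomials in `(x, h)`: `Sum.inl v` is the variable `v` itself and `Sum.inr v` is the corresponding
direction `h_v`. For `ℝ⟨x, x*⟩` the direction of `x_j*` is `h_j*`. -/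
noncomputable def shift {V : Type} (p : FreeAlgebra ℝ V) : Polynomial (FreeAlgebra ℝ (V ⊕ V)) :=
  FreeAlgebra.lift ℝ
    (fun v => Polynomial.C (FreeAlgebra.ι ℝ (Sum.inl v)) +
      Polynomial.X * Polynomial.C (FreeAlgebra.ι ℝ (Sum.inr v))) p

/-- The `k`-th directional derivative `p^{(k)}(x)[h] = (d^k/dt^k) p(x + t h)` at `t = 0`. -/
noncomputable def dirDeriv {V : Type} (k : ℕ) (p : FreeAlgebra ℝ V) : FreeAlgebra ℝ (V ⊕ V) :=
  Polynomial.eval 0 (Polynomial.derivative^[k] (shift p))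

/-- Matrix positivity of a polynomial `q(x)[h]` in symmetric variables `x`, `h`: for every size `n`
and all `g`-tuples `X`, `H` of symmetric real `n × n` matrices, `q(X)[H]` is positive
semidefinite. -/
def MatrixPositive {g : ℕ} (q : FreeAlgebra ℝ (Fin g ⊕ Fin g)) : Prop :=
  ∀ (n : ℕ) (X H : Fin g → Matrix (Fin n) (Fin n) ℝ),
    (∀ j, (X j).IsSymm) → (∀ j, (H j).IsSymm) →
      (FreeAlgebra.lift ℝ (Sum.elim X H) q).PosSemidef

/-- Matrix positivity of a polynomial `q(x, x*)[h, h*]` in free variables: for every size `n` and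
all `g`-tuples `X`, `H` of real `n × n` matrices, the value of `q` at `X, Xᵀ, H, Hᵀ` is positive
semidefinite. -/
def MatrixPositiveFree {g : ℕ}
    (q : FreeAlgebra ℝ ((Fin g ⊕ Fin g) ⊕ (Fin g ⊕ Fin g))) : Prop :=
  ∀ (n : ℕ) (X H : Fin g → Matrix (Fin n) (Fin n) ℝ),
    (FreeAlgebra.lift ℝ
      (Sum.elim (Sum.elim X (fun j => (X j).transpose))
        (Sum.elim H (fun j => (H j).transpose))) q).PosSemidef

end NCPoly

namespace NCPoly

open Polynomial Matrix

/-! Suppose `d = deg p > k` and let `w` be a word of length `d` with coefficient `x ≠ 0`. Label the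
edges of a path `0, …, d` by the letters of `w`; the first `k` edges form `H`, the others `X`, and
the edges of `H` in the first half get weight `s`. Let `A` be the `t^k`-coefficient of `p(X + tH)`.
Only `w` walks from `0` to `d` in at most `d` steps, so `A 0 d = x * s^m` with `m = min k ⌈d/2⌉`.
Closed walks of length at most `d` stay in the half of the path around their base point, so `A 0 0`
is `s^k` times a constant and `A d d` is constant. Positivity of a 2×2 minor gives `x² s^(2m) ≤ B
s^k`; as `2m > k`, this fails for large `s`. -/

/-! ### Words, degree, and evaluation of the derivative at matrices. -/

/-- Evaluation of a noncommutative polynomial, written as a sum over its words. -/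
theorem lift_eq_sum {V : Type} {A : Type*} [Ring A] [Algebra ℝ A] (M : V → A)
    (p : FreeAlgebra ℝ V) :
    FreeAlgebra.lift ℝ M p =
      ∑ u ∈ (FreeAlgebra.equivMonoidAlgebraFreeMonoid (R := ℝ) (X := V) p).coeff.support,
        (FreeAlgebra.equivMonoidAlgebraFreeMonoid (R := ℝ) (X := V) p).coeff u •
          ((FreeMonoid.toList u).map M).prod := by
  have key : FreeAlgebra.lift ℝ M =
      (MonoidAlgebra.lift ℝ A (FreeMonoid V) (FreeMonoid.lift M)).comp
        (FreeAlgebra.equivMonoidAlgebraFreeMonoid (R := ℝ) (X := V)).toAlgHom := by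
    ext v
    simp [FreeAlgebra.equivMonoidAlgebraFreeMonoid]
  rw [key]
  simp only [AlgHom.comp_apply, MonoidAlgebra.lift_apply, Finsupp.sum, FreeMonoid.lift_apply]
  rfl

theorem length_le_degree {V : Type} {p : FreeAlgebra ℝ V} {u : FreeMonoid V}
    (hu : u ∈ (FreeAlgebra.equivMonoidAlgebraFreeMonoid (R := ℝ) (X := V) p).coeff.support) :
    (FreeMonoid.toList u).length ≤ degree p :=
  Finset.le_sup (f := FreeMonoid.length) hu

theorem exists_word_length_eq_degree {V : Type} {p : FreeAlgebra ℝ V} (hp : 0 < degree p) :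
    ∃ u ∈ (FreeAlgebra.equivMonoidAlgebraFreeMonoid (R := ℝ) (X := V) p).coeff.support,
      (FreeMonoid.toList u).length = degree p := by
  have hne : (FreeAlgebra.equivMonoidAlgebraFreeMonoid
      (R := ℝ) (X := V) p).coeff.support.Nonempty := by
    by_contra h
    rw [Finset.not_nonempty_iff_eq_empty] at h
    rw [degree, h] at hp
    simp at hp
  obtain ⟨u, hu, h⟩ := Finset.exists_mem_eq_sup _ hne FreeMonoid.length
  exact ⟨u, hu, h.symm⟩

/-- The entries of the value of `p^{(k)}` at real matrices are `k!` times the `t^k`-coefficients of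
the entries of `p(X + tH)`. -/
theorem lift_dirDeriv_apply {V : Type} {n : Type*} [Fintype n] [DecidableEq n] (k : ℕ)
    (p : FreeAlgebra ℝ V) (Z : V ⊕ V → Matrix n n ℝ) (i j : n) :
    FreeAlgebra.lift ℝ Z (dirDeriv k p) i j =
      k.factorial * (FreeAlgebra.lift ℝ (fun v => (Z (Sum.inl v)).map C +
        (X : ℝ[X]) • (Z (Sum.inr v)).map C) p i j).coeff k := by
  -- Two algebra homomorphisms into polynomials with matrix coefficients agree because they agree on
  -- the variables.
  have key : ((Polynomial.mapAlgHom (FreeAlgebra.lift ℝ Z)).comp (FreeAlgebra.lift ℝ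
      (fun v => Polynomial.C (FreeAlgebra.ι ℝ (Sum.inl v)) +
        Polynomial.X * Polynomial.C (FreeAlgebra.ι ℝ (Sum.inr v))))) =
      (matPolyEquiv (R := ℝ) (n := n)).toAlgHom.comp (FreeAlgebra.lift ℝ
        (fun v => (Z (Sum.inl v)).map C + (X : ℝ[X]) • (Z (Sum.inr v)).map C)) := by
    ext v : 2
    simp [matPolyEquiv_map_smul]
  have key' := DFunLike.congr_fun key p
  have hc := congrArg (fun q => (q.coeff k) i j) key'
  simp only [AlgHom.comp_apply, Polynomial.coe_mapAlgHom, Polynomial.coeff_map] at hc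
  change (FreeAlgebra.lift ℝ Z) ((shift p).coeff k) i j = (matPolyEquiv _).coeff k i j at hc
  rw [matPolyEquiv_coeff_apply] at hc
  rw [← hc, dirDeriv, ← Polynomial.coeff_zero_eq_eval_zero, Polynomial.coeff_iterate_derivative,
    map_nsmul, zero_add, Nat.descFactorial_self, Matrix.smul_apply, nsmul_eq_mul]

/-! ### Matrix products as sums over walks. -/

section Walks

variable {V ι R : Type*} [Fintype ι] [DecidableEq ι] [CommRing R] {δ : ι → ℕ} {z : ι}
  {M N : V → Matrix ι ι R}

/-- A product of fewer than `δ a` matrices, each lowering `δ` by at most one, vanishes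
from `a` to a point `z` with `δ z = 0`. -/
theorem prod_apply_eq_zero_of_length_lt (hz : ∀ a, δ a ≠ 0 → a ≠ z)
    (hM : ∀ v a b, M v a b ≠ 0 → δ a ≤ δ b + 1) :
    ∀ (u : List V) (a : ι), u.length < δ a → (u.map M).prod a z = 0
  | [], a, h => by
    simpa using Matrix.one_apply_ne (hz a (by simp at h; omega))
  | v :: u, a, h => by
    rw [List.map_cons, List.prod_cons, Matrix.mul_apply]
    refine Finset.sum_eq_zero fun b _ => ?_
    by_cases hab : M v a b = 0
    · rw [hab, zero_mul]
    · have := hM v a b hab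
      simp only [List.length_cons] at h
      rw [prod_apply_eq_zero_of_length_lt hz hM u b (by omega), mul_zero]

/-- Closed walks of length at most `L` from `z` only see the edges near `z`. -/
theorem prod_apply_eq_of_local {L : ℕ} (hz : ∀ a, δ a ≠ 0 → a ≠ z)
    (hM : ∀ v a b, M v a b ≠ 0 → δ a ≤ δ b + 1 ∧ δ b ≤ δ a + 1)
    (hN : ∀ v a b, N v a b ≠ 0 → δ a ≤ δ b + 1 ∧ δ b ≤ δ a + 1)
    (hMN : ∀ v a b, δ a + δ b + 1 ≤ L → M v a b = N v a b) :
    ∀ (u : List V) (a : ι), δ a + u.length ≤ L → (u.map M).prod a z = (u.map N).prod a z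
  | [], a, _ => by simp
  | v :: u, a, h => by
    simp only [List.map_cons, List.prod_cons, Matrix.mul_apply]
    simp only [List.length_cons] at h
    refine Finset.sum_congr rfl fun b _ => ?_
    by_cases hb : u.length < δ b
    · rw [prod_apply_eq_zero_of_length_lt hz (fun v a b h => (hM v a b h).1) u b hb,
        prod_apply_eq_zero_of_length_lt hz (fun v a b h => (hN v a b h).1) u b hb,
        mul_zero, mul_zero]
    · rw [hMN v a b (by omega)]
      by_cases hab : N v a b = 0
      · rw [hab, zero_mul, zero_mul]
      · have := hN v a b hab
        rw [prod_apply_eq_of_local hz hM hN hMN u b (by omega)]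

end Walks

/-! ### Matrices of a path labelled by a word. -/

section Path

variable {V : Type} {R : Type*} [CommRing R]

open Classical in
/-- The matrix of the letter `v` on the path `0, 1, …, w.length` whose `i`-th edge, of weight
`c i`, is labelled by the `i`-th letter of `w` upwards, and by its image under `σ` downwards. -/
noncomputable def pathMatrix (σ : V → V) (w : List V) (c : ℕ → R) (v : V) :
    Matrix (Fin (w.length + 1)) (Fin (w.length + 1)) R :=
  fun a b => if ((b : ℕ) = a + 1 ∧ w[(a : ℕ)]? = some v) ∨
    ((a : ℕ) = b + 1 ∧ w[(b : ℕ)]? = some (σ v)) then c (min (a : ℕ) b) else 0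

variable {σ : V → V} {w : List V} {c : ℕ → R}

theorem pathMatrix_involutive (hσ : Function.Involutive σ) (v : V) :
    pathMatrix σ w c (σ v) = (pathMatrix σ w c v)ᵀ := by
  classical
  ext a b
  simp only [pathMatrix, Matrix.transpose_apply, hσ v]
  rw [min_comm (a : ℕ)]
  simp only [or_comm]

theorem adjacent_of_pathMatrix_ne_zero {v : V} {a b : Fin (w.length + 1)}
    (h : pathMatrix σ w c v a b ≠ 0) : (b : ℕ) = a + 1 ∨ (a : ℕ) = b + 1 := by
  unfold pathMatrix at h
  split_ifs at h with h'
  · tauto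
  · exact absurd rfl h

theorem pathMatrix_congr {c' : ℕ → R} {v : V} {a b : Fin (w.length + 1)}
    (h : ((b : ℕ) = a + 1 ∨ (a : ℕ) = b + 1) → c (min (a : ℕ) b) = c' (min (a : ℕ) b)) :
    pathMatrix σ w c v a b = pathMatrix σ w c' v a b := by
  unfold pathMatrix
  split_ifs with h'
  · exact h (by tauto)
  · rfl

theorem pathMatrix_map {S : Type*} [CommRing S] (f : R →+* S) (v : V) :
    (pathMatrix σ w c v).map f = pathMatrix σ w (fun i => f (c i)) v := by
  ext a b
  simp only [Matrix.map_apply, pathMatrix]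
  split_ifs <;> simp

theorem pathMatrix_map_C_add {c₀ c₁ : ℕ → ℝ} (v : V) :
    (pathMatrix σ w c₀ v).map C + (X : ℝ[X]) • (pathMatrix σ w c₁ v).map C =
      pathMatrix σ w (fun i => C (c₀ i) + X * C (c₁ i)) v := by
  ext1 a b
  simp only [Matrix.map_apply, pathMatrix, Matrix.add_apply, Matrix.smul_apply, smul_eq_mul]
  split_ifs <;> simp

open Classical in
/-- The only walk from `a` to the end of the path of minimal length goes straight up. -/
theorem prod_pathMatrix_apply_last :
    ∀ (u : List V) (a : Fin (w.length + 1)), a + u.length = w.length →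
      (u.map (pathMatrix σ w c)).prod a (Fin.last _) =
        if u = w.drop a then ∏ i ∈ Finset.Ico (a : ℕ) w.length, c i else 0
  | [], a, h => by
    have ha : a = Fin.last _ := by
      ext; simpa using h
    subst ha
    simp
  | v :: u, a, h => by
    simp only [List.length_cons] at h
    have hlt : (a : ℕ) < w.length := by omega
    let a' : Fin (w.length + 1) := ⟨a + 1, by omega⟩
    rw [List.map_cons, List.prod_cons, Matrix.mul_apply, Finset.sum_eq_single a']
    · rw [prod_pathMatrix_apply_last u a' (by simp only [a']; omega),
        Finset.prod_eq_prod_Ico_succ_bot hlt]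
      have hdrop : v :: u = w.drop a ↔ w[(a : ℕ)] = v ∧ u = w.drop (a + 1) := by
        rw [List.drop_eq_getElem_cons hlt, List.cons.injEq, eq_comm (a := v)]
      have hedge : pathMatrix σ w c v a a' = if w[(a : ℕ)] = v then c a else 0 := by
        have hget : w[(a : ℕ)]? = some v ↔ w[(a : ℕ)] = v := by
          rw [List.getElem?_eq_getElem hlt, Option.some.injEq]
        unfold pathMatrix
        rw [show min (a : ℕ) (a' : ℕ) = a by simp [a']]
        by_cases hv : w[(a : ℕ)] = v
        · rw [if_pos (Or.inl ⟨rfl, hget.2 hv⟩), if_pos hv]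
        · rw [if_neg hv, if_neg]
          rintro (h' | h')
          · exact hv (hget.1 h'.2)
          · have := h'.1
            simp only [a'] at this
            omega
      rw [hedge]
      by_cases hv : w[(a : ℕ)] = v
      · by_cases hu : u = w.drop (a + 1)
        · rw [if_pos hv, if_pos hu, if_pos (hdrop.2 ⟨hv, hu⟩)]
        · rw [if_neg hu, if_neg fun h' => hu (hdrop.1 h').2, mul_zero]
      · rw [if_neg hv, if_neg fun h' => hv (hdrop.1 h').1, zero_mul]
    · intro b _ hb
      by_cases hab : pathMatrix σ w c v a b = 0
      · rw [hab, zero_mul]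
      · have h1 := adjacent_of_pathMatrix_ne_zero hab
        have h2 : (b : ℕ) ≠ a + 1 := fun h' => hb (Fin.ext h')
        -- A step down leaves `b` farther from the end than the number of remaining letters.
        rw [prod_apply_eq_zero_of_length_lt (δ := fun b : Fin (w.length + 1) => w.length - (b : ℕ)), mul_zero]
        · rintro a h rfl
          simp at h
        · intro v a b h
          have := adjacent_of_pathMatrix_ne_zero h
          omega
        · omega
    · simp

end Path

/-! ### Entries of `p` at the two ends of the path. -/

section Evaluation

variable {V : Type} {R : Type*} [CommRing R] [Algebra ℝ R] {σ : V → V}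

theorem lift_pathMatrix_zero_last {p : FreeAlgebra ℝ V} {w : FreeMonoid V}
    (hw : (FreeMonoid.toList w).length = degree p) (c : ℕ → R) :
    FreeAlgebra.lift ℝ (pathMatrix σ (FreeMonoid.toList w) c) p 0 (Fin.last _) =
      (FreeAlgebra.equivMonoidAlgebraFreeMonoid (R := ℝ) (X := V) p).coeff w •
        ∏ i ∈ Finset.range (degree p), c i := by
  classical
  rw [lift_eq_sum, Matrix.sum_apply, Finset.sum_eq_single w]
  · rw [Matrix.smul_apply, prod_pathMatrix_apply_last _ _ (by simp)]
    rw [if_pos (by rw [Fin.val_zero, List.drop_zero]), Fin.val_zero, ← Finset.range_eq_Ico, hw]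
  · intro u hu huw
    rw [Matrix.smul_apply]
    have hle := length_le_degree hu
    rcases hle.lt_or_eq with h | h
    · rw [prod_apply_eq_zero_of_length_lt
        (δ := fun b : Fin ((FreeMonoid.toList w).length + 1) =>
          (FreeMonoid.toList w).length - (b : ℕ)), smul_zero]
      · rintro a h rfl
        simp at h
      · intro v a b h
        have := adjacent_of_pathMatrix_ne_zero h
        omega
      · simpa [hw] using h
    · rw [prod_pathMatrix_apply_last _ _ (by simp [hw, h]), if_neg, smul_zero]
      simpa using huw
  · intro h
    rw [Finsupp.notMem_support_iff.mp h, zero_smul, Matrix.zero_apply]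

/-- With `δ` the distance to `z`, a closed walk at `z` through the edge `a b` has length at least `δ
a + δ b + 1`, so heavier requirements on `c` are not needed. -/
theorem lift_pathMatrix_congr {p : FreeAlgebra ℝ V} {w : List V} (c c' : ℕ → R)
    {δ : Fin (w.length + 1) → ℕ} {z : Fin (w.length + 1)} (hz : ∀ a, δ a = 0 ↔ a = z)
    (hδ : ∀ a b : Fin (w.length + 1), (b : ℕ) = a + 1 ∨ (a : ℕ) = b + 1 →
      δ a ≤ δ b + 1 ∧ δ b ≤ δ a + 1)
    (hc : ∀ a b : Fin (w.length + 1), ((b : ℕ) = a + 1 ∨ (a : ℕ) = b + 1) →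
      δ a + δ b + 1 ≤ degree p → c (min (a : ℕ) b) = c' (min (a : ℕ) b)) :
    FreeAlgebra.lift ℝ (pathMatrix σ w c) p z z =
      FreeAlgebra.lift ℝ (pathMatrix σ w c') p z z := by
  rw [lift_eq_sum, lift_eq_sum, Matrix.sum_apply, Matrix.sum_apply]
  refine Finset.sum_congr rfl fun u hu => ?_
  rw [Matrix.smul_apply, Matrix.smul_apply,
    prod_apply_eq_of_local (δ := δ) (L := degree p) (fun a h h' => h ((hz a).2 h'))
      (fun v a b h => hδ a b (adjacent_of_pathMatrix_ne_zero h))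
      (fun v a b h => hδ a b (adjacent_of_pathMatrix_ne_zero h))
      (fun v a b h => pathMatrix_congr fun h' => hc a b h' h)]
  rw [(hz z).2 rfl, zero_add]
  exact length_le_degree hu

end Evaluation

/-! ### The weights and their dependence on `s`. -/

/-- Weights on the edges of a path of length `d`: the first `k` edges are directions, and those of
them in the first half are scaled by `s`. -/
noncomputable def directionWeight (d k : ℕ) (s : ℝ) (i : ℕ) : ℝ[X] :=
  if i < k then C (if 2 * i < d then s else 1) * X else 1

theorem prod_directionWeight {d k : ℕ} (hkd : k ≤ d) (s : ℝ) :
    ∏ i ∈ Finset.range d, directionWeight d k s i = C (s ^ min k ((d + 1) / 2)) * X ^ k := by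
  have h1 : ∀ i, directionWeight d k s i =
      C (if i < min k ((d + 1) / 2) then s else 1) * (if i < k then X else 1) := by
    intro i
    unfold directionWeight
    split_ifs <;> first | omega | simp
  have h2 : ∀ (m : ℕ) {S : Type} [CommRing S] (x : S), m ≤ d →
      ∏ i ∈ Finset.range d, (if i < m then x else 1) = x ^ m := by
    intro m S _ x hm
    rw [← Finset.prod_filter, Finset.prod_const]
    congr 1
    rw [show (Finset.range d).filter (· < m) = Finset.range m by ext; simp; omega,
      Finset.card_range]
  rw [Finset.prod_congr rfl fun i _ => h1 i, Finset.prod_mul_distrib, h2 k X hkd, ← map_prod,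
    h2 _ s (by omega)]

/-- On every edge that a closed walk at `0` can reach, introducing `s` amounts to the substitution
`t ↦ s t`, which multiplies the `t^k`-coefficient by `s^k`. -/
theorem coeff_lift_directionWeight_zero {V : Type} {σ : V → V} {p : FreeAlgebra ℝ V} {w : List V}
    (k : ℕ) (s : ℝ) :
    (FreeAlgebra.lift ℝ (pathMatrix σ w (directionWeight (degree p) k s)) p 0 0).coeff k =
      s ^ k * (FreeAlgebra.lift ℝ (pathMatrix σ w
        (directionWeight (degree p) k 1)) p 0 0).coeff k := by
  have h1 : FreeAlgebra.lift ℝ (pathMatrix σ w (directionWeight (degree p) k s)) p 0 0 =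
      FreeAlgebra.lift ℝ (pathMatrix σ w
        (fun i => aeval (C s * X : ℝ[X]) (directionWeight (degree p) k 1 i))) p 0 0 := by
    refine lift_pathMatrix_congr _ _ (δ := fun a => a) (fun a => by simp) (by omega) ?_
    intro a b hab h
    have h2 : 2 * min (a : ℕ) b < degree p := by omega
    simp only [directionWeight, if_pos h2]
    split_ifs <;> simp
  have h2 : (FreeAlgebra.lift ℝ (pathMatrix σ w
      (fun i => aeval (C s * X : ℝ[X]) (directionWeight (degree p) k 1 i)))) =
      (AlgHom.mapMatrix (aeval (C s * X : ℝ[X]))).comp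
        (FreeAlgebra.lift ℝ (pathMatrix σ w (directionWeight (degree p) k 1))) := by
    ext1
    funext v
    simp only [Function.comp_apply, AlgHom.comp_apply, FreeAlgebra.lift_ι_apply,
      AlgHom.mapMatrix_apply]
    exact (pathMatrix_map ((aeval (C s * X : ℝ[X]) : ℝ[X] →ₐ[ℝ] ℝ[X]) : ℝ[X] →+* ℝ[X]) v).symm
  rw [h1, h2]
  simp only [AlgHom.comp_apply, AlgHom.mapMatrix_apply, Matrix.map_apply]
  rw [← Polynomial.comp_eq_aeval, Polynomial.comp_C_mul_X_coeff, mul_comm]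

/-- Edges seen from the far end satisfy `d ≤ 2 * i`, hence carry no `s`. For odd `d` the middle edge
is seen from neither end. -/
theorem lift_directionWeight_last {V : Type} {σ : V → V} {p : FreeAlgebra ℝ V} {w : List V}
    (hw : w.length = degree p) (k : ℕ) (s : ℝ) :
    FreeAlgebra.lift ℝ (pathMatrix σ w (directionWeight (degree p) k s)) p
        (Fin.last _) (Fin.last _) =
      FreeAlgebra.lift ℝ (pathMatrix σ w (directionWeight (degree p) k 1)) p
        (Fin.last _) (Fin.last _) := by
  refine lift_pathMatrix_congr _ _ (δ := fun a => w.length - a) (fun a => ?_) (by omega) ?_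
  · rw [Fin.ext_iff, Fin.val_last]
    omega
  · intro a b hab h
    have h2 : ¬ 2 * min (a : ℕ) b < degree p := by omega
    simp only [directionWeight, if_neg h2]

theorem sq_apply_le_of_posSemidef {n : Type*} [Fintype n] [DecidableEq n] {A : Matrix n n ℝ}
    (hA : A.PosSemidef) (i j : n) : A i j ^ 2 ≤ A i i * A j j := by
  have h := (hA.submatrix ![i, j]).det_nonneg
  have hs : A j i = A i j := by simpa using hA.isHermitian.apply i j
  simp only [Matrix.det_fin_two, Matrix.submatrix_apply, Matrix.cons_val_zero,
    Matrix.cons_val_one, hs] at h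
  nlinarith

/-! ### The 2×2 minor and the contradiction. -/

/-- If `p^{(k)}` is positive semidefinite at all tuples of matrices that are compatible with an
involution `σ` of the variables, then `p` has degree at most `k`. -/
theorem degree_le_of_posSemidef {V : Type} {σ : V → V} (hσ : Function.Involutive σ) {k : ℕ}
    (hk : 1 ≤ k) (p : FreeAlgebra ℝ V)
    (hp : ∀ (n : ℕ) (X H : V → Matrix (Fin n) (Fin n) ℝ), (∀ v, X (σ v) = (X v)ᵀ) →
      (∀ v, H (σ v) = (H v)ᵀ) → (FreeAlgebra.lift ℝ (Sum.elim X H) (dirDeriv k p)).PosSemidef) :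
    degree p ≤ k := by
  by_contra! hd
  obtain ⟨u, hu, hlen⟩ := exists_word_length_eq_degree (p := p) (by omega)
  set w := FreeMonoid.toList u with hw
  set d := degree p with hd'
  set P : ℝ → Matrix _ _ ℝ[X] := fun s =>
    FreeAlgebra.lift ℝ (pathMatrix σ w (directionWeight d k s)) p with hP
  set m := min k ((d + 1) / 2) with hm
  set x := (FreeAlgebra.equivMonoidAlgebraFreeMonoid (R := ℝ) (X := V) p).coeff u
  have hx : x ≠ 0 := Finsupp.mem_support_iff.mp hu
  have hoff : ∀ s, (P s 0 (Fin.last _)).coeff k = x * s ^ m := by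
    intro s
    simp only [hP]
    rw [lift_pathMatrix_zero_last hlen, prod_directionWeight hd.le]
    rw [Polynomial.coeff_smul, Polynomial.coeff_C_mul_X_pow, if_pos rfl, smul_eq_mul]
  have hzero : ∀ s, (P s 0 0).coeff k = s ^ k * (P 1 0 0).coeff k :=
    coeff_lift_directionWeight_zero k
  have hlast : ∀ s, P s (Fin.last _) (Fin.last _) = P 1 (Fin.last _) (Fin.last _) :=
    lift_directionWeight_last hlen k
  have hineq : ∀ s, ((P s 0 (Fin.last _)).coeff k) ^ 2 ≤
      (P s 0 0).coeff k * (P s (Fin.last _) (Fin.last _)).coeff k := by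
    intro s
    have h := hp _ (pathMatrix σ w (fun i => if i < k then 0 else 1))
      (pathMatrix σ w (fun i => if i < k then (if 2 * i < d then s else 1) else 0))
      (pathMatrix_involutive hσ) (pathMatrix_involutive hσ)
    have hent := sq_apply_le_of_posSemidef h 0 (Fin.last _)
    have hfun : (fun i => C (if i < k then (0 : ℝ) else 1) +
        X * C (if i < k then (if 2 * i < d then s else 1) else 0)) = directionWeight d k s := by
      funext i
      unfold directionWeight
      split_ifs <;> simp
    simp only [lift_dirDeriv_apply, Sum.elim_inl, Sum.elim_inr, pathMatrix_map_C_add] at hent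
    rw [hfun] at hent
    have hf : (0 : ℝ) < (k.factorial : ℝ) ^ 2 := by positivity
    refine le_of_mul_le_mul_left ?_ hf
    calc _ = _ := by rw [← mul_pow]
      _ ≤ _ := hent
      _ = _ := by ring
  set B := (P 1 0 0).coeff k * (P 1 (Fin.last _) (Fin.last _)).coeff k
  have hx2 : 0 < x ^ 2 := by positivity
  -- `1 ≤ s` makes powers of `s` monotone; the other bound gives `B < x ^ 2 * s`.
  set s : ℝ := max 1 (B / x ^ 2 + 1)
  have hs1 : 1 ≤ s := le_max_left _ _
  have hs2 : B / x ^ 2 + 1 ≤ s := le_max_right _ _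
  have h := hineq s
  rw [hoff, hzero, hlast] at h
  have h3 : s ^ k * (x ^ 2 * s) ≤ s ^ k * B := by
    calc s ^ k * (x ^ 2 * s) = x ^ 2 * s ^ (k + 1) := by ring
      -- `k + 1 ≤ 2 * m`: if `m = k` because `1 ≤ k`, otherwise because `2 * m ≥ d > k`.
      _ ≤ x ^ 2 * s ^ (m * 2) := by
        gcongr
        omega
      _ = (x * s ^ m) ^ 2 := by ring
      _ ≤ _ := h
      _ = s ^ k * B := by ring
  have h4 : x ^ 2 * s ≤ B := le_of_mul_le_mul_left h3 (by positivity)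
  have h5 : B < x ^ 2 * s := by
    calc B < B + x ^ 2 := by linarith
      _ = x ^ 2 * (B / x ^ 2 + 1) := by field_simp
      _ ≤ x ^ 2 * s := by gcongr
  linarith

end NCPoly

theorem mainTheorem1 (g k : ℕ) (hk : 1 ≤ k) :
    (∀ p : FreeAlgebra ℝ (Fin g), star p = p →
      NCPoly.MatrixPositive (NCPoly.dirDeriv k p) → NCPoly.degree p ≤ k) ∧
    (∀ p : FreeAlgebra ℝ (Fin g ⊕ Fin g), NCPoly.adjoint p = p →
      NCPoly.MatrixPositiveFree (NCPoly.dirDeriv k p) → NCPoly.degree p ≤ k) := by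
  refine ⟨fun p _ hp => ?_, fun p _ hp => ?_⟩
  · refine NCPoly.degree_le_of_posSemidef (σ := id) (fun _ => rfl) hk p fun n X H hX hH => ?_
    exact hp n X H (fun j => (hX j).symm) (fun j => (hH j).symm)
  · refine NCPoly.degree_le_of_posSemidef (σ := Sum.swap) Sum.swap_swap hk p
      fun n X H hX hH => ?_
    have h := hp n (fun j => X (Sum.inl j)) (fun j => H (Sum.inl j))
    -- A tuple compatible with `Sum.swap` is determined by its `Sum.inl` half.
    have elim_eq : ∀ Y : Fin g ⊕ Fin g → Matrix (Fin n) (Fin n) ℝ,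
        (∀ v, Y v.swap = (Y v).transpose) →
        Sum.elim (fun j => Y (Sum.inl j)) (fun j => (Y (Sum.inl j)).transpose) = Y := by
      intro Y hY
      funext v
      rcases v with j | j
      · rfl
      · exact (hY (Sum.inl j)).symm
    rwa [elim_eq X hX, elim_eq H hH] at h
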